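/- Let $S$ be a non-compact surface (a connected, second countable topological $2$-manifold without boundary), with a metric $d$ inducing its topology, and let $f:S\to S$ be a topologically Anosov (TA) homeomorphism, that is: (i) $f$ is topologically expansive: there is a continuous $\epsilon:S\to(0,\infty)$ such that for all $x\neq y$ in $S$ there is $k\in\mathbb Z$ with $d(f^k(x),f^k(y))>\epsilon(f^k(x))$; (ii) $f$ has the topological shadowing property: for every continuous $\epsilon:S\to(0,\infty)$ there is a continuous $\delta:S\to(0,\infty)$ such that for every sequence $(x_n)_{n\in\mathbb Z}$ in $S$ with $d(f(x_n),x_{n+1})<\delta(f(x_n))$ for all $n\in\mathbb Z$ there is $z\in S$ with $d(x_n,f^n(z))<\epsilon(x_n)$ for all $n\in\mathbb Z$. The basic sets of $f$ are the members of the spectral decomposition of $f$, i.e. of the partition of the non-wandering set $\Omega(f)$ into nonempty closed invariant sets on which $f$ is topologically transitive. A basic set $\Lambda$ is attracting if it has an open neighbourhood $U$ with $\overline{f(U)}\subset U$ and $\bigcap_{n\ge 0}f^n(U)=\Lambda$. Let $x\in S$ be a point whose backward orbit $\{f^{-n}(x):n\ge 0\}$ is unbounded, i.e. not contained in any compact subset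 of $S$. Then there is an attracting basic set $\Lambda$ of $f$ with $\omega(x)\subset\Lambda$, where $\omega(x)$ is the set of all limits of subsequences $f^{n_k}(x)$ with $n_k\to+\infty$. -/

import Mathlib

open Set Filter Topology

namespace TopAnosov

variable {S : Type*}

/-- Topological expansiveness, with a strictly positive continuous expansivity function. -/
def TopExpansive [MetricSpace S] (f : S ≃ₜ S) : Prop :=
  ∃ ε : S → ℝ, Continuous ε ∧ (∀ x, 0 < ε x) ∧
    ∀ x y : S, x ≠ y → ∃ k : ℤ, ε ((f ^ k) x) < dist ((f ^ k) x) ((f ^ k) y)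

/-- A bi-infinite `δ`-pseudo-orbit, for a function `δ`. -/
def IsPseudoOrbit [MetricSpace S] (f : S ≃ₜ S) (δ : S → ℝ) (u : ℤ → S) : Prop :=
  ∀ n : ℤ, dist (f (u n)) (u (n + 1)) < δ (f (u n))

/-- The orbit of `z` `ε`-shadows the sequence `u`. -/
def Shadows [MetricSpace S] (f : S ≃ₜ S) (ε : S → ℝ) (u : ℤ → S) (z : S) : Prop :=
  ∀ n : ℤ, dist (u n) ((f ^ n) z) < ε (u n)

/-- The topological shadowing property. -/
def TopShadowing [MetricSpace S] (f : S ≃ₜ S) : Prop :=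
  ∀ ε : S → ℝ, Continuous ε → (∀ x, 0 < ε x) →
    ∃ δ : S → ℝ, Continuous δ ∧ (∀ x, 0 < δ x) ∧
      ∀ u : ℤ → S, IsPseudoOrbit f δ u → ∃ z : S, Shadows f ε u z

/-- Topologically Anosov homeomorphisms. -/
def IsTopAnosov [MetricSpace S] (f : S ≃ₜ S) : Prop :=
  TopExpansive f ∧ TopShadowing f

variable [TopologicalSpace S]

/-- The non-wandering set `Ω(f)`. -/
def nonwanderingSet (f : S ≃ₜ S) : Set S :=
  {x | ∀ U : Set S, IsOpen U → x ∈ U → ∃ n : ℕ, 0 < n ∧ (((f ^ n) '' U) ∩ U).Nonempty}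

/-- The restriction of `f` to the (invariant) set `Λ` is topologically transitive. -/
def TransitiveOn (f : S ≃ₜ S) (Λ : Set S) : Prop :=
  ∀ U V : Set S, IsOpen U → IsOpen V → (U ∩ Λ).Nonempty → (V ∩ Λ).Nonempty →
    ∃ n : ℕ, (((f ^ n) '' (U ∩ Λ)) ∩ (V ∩ Λ)).Nonempty

/-- A spectral decomposition: a partition of `Ω(f)` into nonempty closed invariant sets on which
`f` is topologically transitive. -/
structure IsSpectralDecomposition (f : S ≃ₜ S) (𝓑 : Set (Set S)) : Prop where
  sUnion_eq : ⋃₀ 𝓑 = nonwanderingSet f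
  pairwiseDisjoint : 𝓑.PairwiseDisjoint id
  nonempty : ∀ Λ ∈ 𝓑, Λ.Nonempty
  isClosed : ∀ Λ ∈ 𝓑, IsClosed Λ
  invariant : ∀ Λ ∈ 𝓑, f '' Λ = Λ
  transitive : ∀ Λ ∈ 𝓑, TransitiveOn f Λ

/-- The basic sets (basic pieces) are the members of the spectral decomposition. -/
def IsBasicSet (f : S ≃ₜ S) (Λ : Set S) : Prop :=
  ∃ 𝓑 : Set (Set S), IsSpectralDecomposition f 𝓑 ∧ Λ ∈ 𝓑

/-- `Λ` is attracting: it has an open neighbourhood `U` with `closure (f U) ⊆ U` and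
`⋂_{n ≥ 0} fⁿ(U) = Λ`. -/
def IsAttracting (f : S ≃ₜ S) (Λ : Set S) : Prop :=
  ∃ U : Set S, IsOpen U ∧ Λ ⊆ U ∧ closure (f '' U) ⊆ U ∧ (⋂ n : ℕ, (f ^ n) '' U) = Λ

/-- The backward orbit of `x` is unbounded: it is not contained in any compact set. -/
def UnboundedBackwardOrbit (f : S ≃ₜ S) (x : S) : Prop :=
  ¬ ∃ K : Set S, IsCompact K ∧ ∀ n : ℕ, (f ^ (-(n : ℤ))) x ∈ K

/-- The `ω`-limit set of the point `x` under forward iteration of `f`. -/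
def omegaLim (f : S ≃ₜ S) (x : S) : Set S :=
  omegaLimit atTop (fun (n : ℕ) (y : S) => (f ^ n) y) {x}

end TopAnosov

/-! Since the backward orbit of x leaves every compact set, a positive continuous ε can shrink so
fast along some f^(-n_k)(x) that x alone ε-shadows its own backward orbit (`exists_rigid_scale`).
Take δ from shadowing at such a scale. Any δ-chain from x, preceded by the backward orbit of x and
followed by the forward orbit of its end, is then shadowed by x itself. The set U of ends of these
chains is open and trapping. If p lies in every fⁿ(U), then from time -n on the orbit of p follows
that of some f^N(x) with N ≥ n. Expansivity makes these points accumulate at p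
(`IsExpansivity.tendsto`), so ⋂ fⁿ(U) = ω(x).

It remains to see that ω(x) is a basic set. It is nonempty: were the forward orbit unbounded too,
rigidity on both sides would isolate x (`exists_compact_forward`). It is a chain class, and the
chain classes in Ω(f) form a spectral decomposition. Their transitivity (`transitiveOn_chainClass`)
comes from shadowing periodic pseudo-orbits, while `IsExpansivity.reach_of_step` keeps the periodic
point in the class. -/

namespace TopAnosov

/-! ### Integer powers of a homeomorphism. -/

section Powers

variable {S : Type*} [TopologicalSpace S]

theorem zpow_add_apply (f : S ≃ₜ S) (m n : ℤ) (x : S) :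
    (f ^ (m + n)) x = (f ^ m) ((f ^ n) x) := by
  rw [zpow_add]; rfl

theorem zpow_natCast_apply (f : S ≃ₜ S) (n : ℕ) (x : S) : (f ^ (n : ℤ)) x = (f ^ n) x := by
  rw [zpow_natCast]

theorem zpow_zero_apply (f : S ≃ₜ S) (x : S) : (f ^ (0 : ℤ)) x = x := by
  rw [zpow_zero]; rfl

theorem zpow_one_apply (f : S ≃ₜ S) (x : S) : (f ^ (1 : ℤ)) x = f x := by
  rw [zpow_one]

theorem zpow_add_one_apply (f : S ≃ₜ S) (n : ℤ) (x : S) : (f ^ (n + 1)) x = f ((f ^ n) x) := by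
  rw [add_comm, zpow_add_apply, zpow_one_apply]

theorem zpow_neg_apply_zpow (f : S ≃ₜ S) (n : ℤ) (x : S) : (f ^ (-n)) ((f ^ n) x) = x := by
  rw [← zpow_add_apply, neg_add_cancel, zpow_zero_apply]

theorem zpow_apply_zpow_neg (f : S ≃ₜ S) (n : ℤ) (x : S) : (f ^ n) ((f ^ (-n)) x) = x := by
  rw [← zpow_add_apply, add_neg_cancel, zpow_zero_apply]

theorem inv_pow_apply (f : S ≃ₜ S) (n : ℕ) (x : S) : (f⁻¹ ^ n) x = (f ^ (-(n : ℤ))) x := by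
  rw [zpow_neg, zpow_natCast, inv_pow]

theorem zpow_mul_apply_of_fixed (f : S ≃ₜ S) {N : ℤ} {z : S} (hz : (f ^ N) z = z) (k : ℤ) :
    (f ^ (N * k)) z = z := by
  induction k with
  | zero => rw [mul_zero, zpow_zero_apply]
  | succ k ih => rw [mul_add, mul_one, zpow_add_apply, hz, ih]
  | pred k ih =>
    have h : (f ^ (-N)) z = z := by
      conv_lhs => rw [← hz]
      exact zpow_neg_apply_zpow f N z
    rw [show N * (-(k : ℤ) - 1) = N * -k + -N by ring, zpow_add_apply, h, ih]

end Powers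

/-! ### Positive continuous scales with prescribed smallness. -/

section Minorant

variable {S : Type*} [MetricSpace S]

/-- A local and downward closed condition is satisfied by a positive continuous function. -/
theorem exists_continuous_pos_of_local (P : S → ℝ → Prop)
    (anti : ∀ y c c', 0 < c' → c' ≤ c → P y c → P y c')
    (loc : ∀ x, ∃ c > 0, ∀ᶠ y in 𝓝 x, P y c) :
    ∃ ε : S → ℝ, Continuous ε ∧ (∀ x, 0 < ε x) ∧ ∀ x, P x (ε x) := by
  -- The admissible values at each point form an interval, so local constants glue by a partition of
  -- unity.
  obtain ⟨g, hg⟩ := exists_continuous_forall_mem_convex_of_local_const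
    (t := fun y => {c : ℝ | 0 < c ∧ P y c}) (fun y => by
      apply OrdConnected.convex
      refine ⟨fun a ha b hb c hc => ?_⟩
      have hc0 : 0 < c := lt_of_lt_of_le ha.1 hc.1
      exact ⟨hc0, anti y b c hc0 hc.2 hb.2⟩)
    (fun x => by
      obtain ⟨c, hc, h⟩ := loc x
      exact ⟨c, h.mono fun y hy => ⟨hc, hy⟩⟩)
  exact ⟨g, g.continuous, fun x => (hg x).1, fun x => (hg x).2⟩

/-- A scale adapted to the expansivity function `e`: twice it is below `e` at all nearby points,
and balls of twice its size are relatively compact. -/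
structure IsFine (e ε : S → ℝ) : Prop where
  continuous : Continuous ε
  pos : ∀ x, 0 < ε x
  two_mul_le : ∀ x y, dist x y < ε x → 2 * ε x ≤ e y
  isCompact : ∀ x, IsCompact (Metric.closedBall x (2 * ε x))

theorem IsFine.le {e ε : S → ℝ} (h : IsFine e ε) (x : S) : ε x ≤ e x := by
  have h1 := h.two_mul_le x x (by simpa using h.pos x)
  have h2 := h.pos x
  linarith

theorem IsFine.min {e ε ε' : S → ℝ} (h : IsFine e ε) (hc : Continuous ε') (hp : ∀ x, 0 < ε' x) :
    IsFine e fun x => min (ε x) (ε' x) where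
  continuous := h.continuous.min hc
  pos x := lt_min (h.pos x) (hp x)
  two_mul_le x y hxy := by
    have h1 := h.two_mul_le x y (lt_of_lt_of_le hxy (min_le_left _ _))
    have h2 := min_le_left (ε x) (ε' x)
    linarith
  isCompact x := (h.isCompact x).of_isClosed_subset Metric.isClosed_closedBall
    (Metric.closedBall_subset_closedBall (by
      have h2 := min_le_left (ε x) (ε' x)
      linarith))

theorem exists_isFine [LocallyCompactSpace S] {e : S → ℝ} (he : Continuous e)
    (hpos : ∀ x, 0 < e x) : ∃ ε, IsFine e ε := by
  obtain ⟨ε, h1, h2, h3⟩ := exists_continuous_pos_of_local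
    (fun (x : S) c => (∀ y, dist x y < c → 2 * c ≤ e y) ∧ IsCompact (Metric.closedBall x (2 * c)))
    (fun y c c' _ hcc' h => ⟨fun z hz => by
        have := h.1 z (lt_of_lt_of_le hz hcc')
        linarith,
      h.2.of_isClosed_subset Metric.isClosed_closedBall
        (Metric.closedBall_subset_closedBall (by linarith))⟩)
    (fun x => by
      obtain ⟨K, hK, hxK⟩ := exists_compact_mem_nhds x
      have hn : K ∩ {y | e x / 2 < e y} ∈ 𝓝 x := inter_mem hxK
        (he.continuousAt.eventually (lt_mem_nhds (by linarith [hpos x])))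
      obtain ⟨r, hr, hrs⟩ := Metric.mem_nhds_iff.1 hn
      -- For y within r/4 of x, the closed ball about y of radius 2 · r/4 stays inside the r-ball
      -- about x, where e exceeds e x / 2.
      refine ⟨min (e x / 4) (r / 4), lt_min (by linarith [hpos x]) (by linarith), ?_⟩
      filter_upwards [Metric.ball_mem_nhds x (show 0 < r / 4 by linarith)] with y hy
      rw [Metric.mem_ball] at hy
      have m1 := min_le_left (e x / 4) (r / 4)
      have m2 := min_le_right (e x / 4) (r / 4)
      refine ⟨fun z hz => ?_, ?_⟩
      · have hz' : z ∈ Metric.ball x r := by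
          rw [Metric.mem_ball]
          have := dist_triangle z y x
          rw [dist_comm z y] at this
          linarith
        have := (hrs hz').2
        simp only [mem_ofPred_eq] at this
        linarith
      · refine hK.of_isClosed_subset Metric.isClosed_closedBall fun z hz => ?_
        refine (hrs ?_).1
        rw [Metric.mem_closedBall] at hz
        rw [Metric.mem_ball]
        have := dist_triangle z y x
        linarith)
  exact ⟨ε, h1, h2, fun x => (h3 x).1, fun x => (h3 x).2⟩

/-- If the forward `g`-orbit of `x` leaves every compact set, then at a suitable scale it is
shadowed by `x` only. -/
theorem exists_rigid_scale [LocallyCompactSpace S] [SigmaCompactSpace S] (g : S ≃ₜ S) (x : S)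
    (hx : ¬ ∃ K : Set S, IsCompact K ∧ ∀ n : ℕ, (g ^ n) x ∈ K) :
    ∃ ε : S → ℝ, Continuous ε ∧ (∀ y, 0 < ε y) ∧
      ∀ z, (∀ n : ℕ, dist ((g ^ n) x) ((g ^ n) z) < ε ((g ^ n) x)) → z = x := by
  let K := CompactExhaustion.choice S
  have hex : ∀ k : ℕ, ∃ n : ℕ, (g ^ n) x ∉ K k := fun k => by
    by_contra! h
    exact hx ⟨K k, K.isCompact k, h⟩
  choose n hn using hex
  -- Continuity of g^(-n k): closeness at time n k forces closeness to x at time 0.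
  have hc : ∀ k : ℕ, ∃ c > 0, ∀ q : S, dist ((g ^ n k) x) ((g ^ n k) q) < c →
      dist x q < 1 / ((k : ℝ) + 1) := fun k => by
    obtain ⟨c, hc, h⟩ := Metric.continuousAt_iff.1
      ((g ^ n k).symm.continuous.continuousAt (x := (g ^ n k) x)) (1 / ((k : ℝ) + 1))
      (by positivity)
    refine ⟨c, hc, fun q hq => ?_⟩
    have := h (x := (g ^ n k) q) (by rwa [dist_comm])
    rw [Homeomorph.symm_apply_apply, Homeomorph.symm_apply_apply] at this
    rwa [dist_comm]
  choose c hc0 hc using hc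
  obtain ⟨ε, h1, h2, h3⟩ := exists_continuous_pos_of_local
    (fun (y : S) r => ∀ k, y = (g ^ n k) x → r ≤ c k)
    (fun y a b _ hab h k hk => hab.trans (h k hk))
    (fun y => by
      obtain ⟨m, hm⟩ := K.exists_mem y
      have hm' : ∀ᶠ z in 𝓝 y, z ∈ K (m + 1) :=
        mem_interior_iff_mem_nhds.1 (K.subset_interior_succ m hm)
      -- Near y only the constraints with k ≤ m matter, because the k-th orbit point lies outside `K
      -- k`.
      have hpos : ∃ r > 0, ∀ k ≤ m, r ≤ c k := by
        refine ⟨(Finset.range (m + 1)).inf' Finset.nonempty_range_add_one c, ?_, fun k hk => ?_⟩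
        · rw [gt_iff_lt, Finset.lt_inf'_iff]
          exact fun k _ => hc0 k
        · exact Finset.inf'_le _ (by simp; omega)
      obtain ⟨r, hr, hrc⟩ := hpos
      refine ⟨r, hr, hm'.mono fun z hz k hk => hrc k ?_⟩
      by_contra! hlt
      exact hn k (hk ▸ K.subset (show m + 1 ≤ k from hlt) hz))
  refine ⟨ε, h1, h2, fun z hz => ?_⟩
  have hlt : ∀ k : ℕ, dist x z < 1 / ((k : ℝ) + 1) := fun k =>
    hc k z (lt_of_lt_of_le (hz (n k)) (h3 _ k rfl))
  have : dist x z ≤ 0 :=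
    ge_of_tendsto' tendsto_one_div_add_atTop_nhds_zero_nat fun k => (hlt k).le
  exact (dist_le_zero.1 this).symm

end Minorant

/-! ### Chains and the pseudo-orbits built from them. -/

section Chains

variable {S : Type*} [MetricSpace S]

/-- There is a `δ`-chain of `f` of positive length from the first point to the second. -/
def Chain (f : S ≃ₜ S) (δ : S → ℝ) : S → S → Prop :=
  Relation.TransGen fun a b => dist (f a) b < δ (f a)

/-- The second point is reached from the first by `δ`-chains for every positive continuous `δ`. -/
def Reach (f : S ≃ₜ S) (a b : S) : Prop :=
  ∀ δ : S → ℝ, Continuous δ → (∀ x, 0 < δ x) → Chain f δ a b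

variable {f : S ≃ₜ S}

theorem Reach.trans {a b c : S} (h : Reach f a b) (h' : Reach f b c) : Reach f a c :=
  fun δ h1 h2 => Relation.TransGen.trans (h δ h1 h2) (h' δ h1 h2)

theorem reach_map (f : S ≃ₜ S) (a : S) : Reach f a (f a) :=
  fun δ _ h2 => Relation.TransGen.single (by simpa using h2 (f a))

theorem reach_pow (f : S ≃ₜ S) (a : S) (n : ℕ) : Reach f a ((f ^ ((n : ℤ) + 1)) a) := by
  induction n with
  | zero => simpa using reach_map f a
  | succ n ih =>
    have := ih.trans (reach_map f _)
    rwa [← zpow_add_one_apply] at this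

theorem reach_zpow (f : S ≃ₜ S) (a : S) {n : ℤ} (hn : 0 < n) : Reach f a ((f ^ n) a) := by
  obtain ⟨k, rfl⟩ : ∃ k : ℕ, n = (k : ℤ) + 1 := ⟨(n - 1).toNat, by omega⟩
  exact reach_pow f a k

theorem reach_of_zpow_neg (f : S ≃ₜ S) (a : S) {n : ℤ} (hn : 0 < n) :
    Reach f ((f ^ (-n)) a) a := by
  simpa only [zpow_apply_zpow_neg] using reach_zpow f ((f ^ (-n)) a) hn

/-- Moving the start of a chain. -/
theorem Chain.exists_start {δ : S → ℝ} (hδ : Continuous δ) (hpos : ∀ x, 0 < δ x) (p : S) :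
    ∃ U ∈ 𝓝 p, ∀ p' ∈ U, ∀ q, Chain f (fun x => δ x / 2) p' q → Chain f δ p q := by
  have hn : ∀ᶠ p' in 𝓝 p, dist (f p) (f p') + δ (f p') / 2 < δ (f p) := by
    have hcont : Continuous fun p' => dist (f p) (f p') + δ (f p') / 2 := by fun_prop
    refine hcont.continuousAt.eventually (gt_mem_nhds ?_)
    have := hpos (f p)
    simp only [dist_self]
    linarith
  refine ⟨_, hn, fun p' hp' q hq => ?_⟩
  simp only [mem_ofPred_eq] at hp'
  obtain ⟨b, hb, hbq⟩ := Relation.TransGen.head'_iff.1 hq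
  refine Relation.TransGen.head' (b := b) ?_
    (Relation.ReflTransGen.mono
      (fun a b h => lt_of_lt_of_le h (by simp only; linarith [hpos (f a)])) _ _ hbq)
  have := dist_triangle (f p) (f p') b
  linarith

/-- Moving the end of a chain. -/
theorem Chain.exists_end {δ : S → ℝ} (hδ : Continuous δ) (hpos : ∀ x, 0 < δ x) (q : S) :
    ∃ δ' : S → ℝ, Continuous δ' ∧ (∀ x, 0 < δ' x) ∧
      ∃ V ∈ 𝓝 q, ∀ q' ∈ V, ∀ p, Chain f δ' p q' → Chain f δ p q := by
  have hq := hpos q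
  obtain ⟨r, hr, hrs⟩ := Metric.mem_nhds_iff.1
    (hδ.continuousAt.eventually (lt_mem_nhds (show δ q / 2 < δ q by linarith)))
  -- The last jump must start within r of q, where δ exceeds δ q / 2; the jump and the move from q'
  -- to q each cost less than δ q / 4.
  refine ⟨fun x => min (δ x) (min (δ q / 4) (r / 2)), by fun_prop,
    fun x => lt_min (hpos x) (lt_min (by linarith) (by linarith)),
    Metric.ball q (min (δ q / 4) (r / 2)),
    Metric.ball_mem_nhds _ (lt_min (by linarith) (by linarith)), fun q' hq' p hp => ?_⟩
  obtain ⟨a, hpa, ha⟩ := Relation.TransGen.tail'_iff.1 hp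
  refine Relation.TransGen.tail' (b := a)
    (Relation.ReflTransGen.mono (fun a b h => lt_of_lt_of_le h (min_le_left _ _)) _ _ hpa) ?_
  rw [Metric.mem_ball] at hq'
  have h1 := lt_of_lt_of_le ha (min_le_right _ _)
  have m1 := min_le_left (δ q / 4) (r / 2)
  have m2 := min_le_right (δ q / 4) (r / 2)
  have ht := dist_triangle (f a) q' q
  have h2 : δ q / 2 < δ (f a) := hrs (Metric.mem_ball.2 (by linarith))
  linarith

theorem Chain.exists_perturb {δ : S → ℝ} (hδ : Continuous δ) (hpos : ∀ x, 0 < δ x) (p q : S) :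
    ∃ δ' : S → ℝ, Continuous δ' ∧ (∀ x, 0 < δ' x) ∧ ∃ U ∈ 𝓝 p, ∃ V ∈ 𝓝 q,
      ∀ p' ∈ U, ∀ q' ∈ V, Chain f δ' p' q' → Chain f δ p q := by
  obtain ⟨δ', h1, h2, V, hV, h3⟩ := Chain.exists_end (f := f) hδ hpos q
  obtain ⟨U, hU, h4⟩ := Chain.exists_start (f := f) h1 h2 p
  exact ⟨fun x => δ' x / 2, by fun_prop, fun x => by linarith [h2 x], U, hU, V, hV,
    fun p' hp' q' hq' h => h3 q' hq' p (h4 p' hp' q' h)⟩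

theorem reach_of_frequently {ι : Type*} {l : Filter ι} [l.NeBot] {a b : ι → S} {p q : S}
    (ha : Tendsto a l (𝓝 p)) (hb : Tendsto b l (𝓝 q)) (h : ∀ᶠ i in l, Reach f (a i) (b i)) :
    Reach f p q := by
  intro δ h1 h2
  obtain ⟨δ', h3, h4, U, hU, V, hV, h5⟩ := Chain.exists_perturb (f := f) h1 h2 p q
  obtain ⟨i, hi, hiU, hiV⟩ := (h.and ((ha.eventually hU).and (hb.eventually hV))).exists
  exact h5 _ hiU _ hiV (hi δ' h3 h4)

/-- Follow `u` up to time `m`, then jump to `c` and follow its orbit. -/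
theorem IsPseudoOrbit.exists_splice {δ : S → ℝ} (hpos : ∀ x, 0 < δ x) {u : ℤ → S}
    (hu : IsPseudoOrbit f δ u) {m : ℤ} {c : S} (hc : dist (f (u m)) c < δ (f (u m))) :
    ∃ v : ℤ → S, IsPseudoOrbit f δ v ∧ (∀ n ≤ m, v n = u n) ∧
      ∀ n : ℤ, 0 ≤ n → v (m + 1 + n) = (f ^ n) c := by
  refine ⟨fun n => if n ≤ m then u n else (f ^ (n - m - 1)) c, fun n => ?_, fun n hn => if_pos hn,
    fun n hn => ?_⟩
  · rcases lt_trichotomy n m with h | rfl | h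
    · simp only [if_pos h.le, if_pos (show n + 1 ≤ m by omega)]
      exact hu n
    · simp only [if_pos le_rfl, if_neg (show ¬ n + 1 ≤ n by omega)]
      rw [show n + 1 - n - 1 = 0 by ring, zpow_zero_apply]
      exact hc
    · simp only [if_neg (show ¬ n ≤ m by omega), if_neg (show ¬ n + 1 ≤ m by omega)]
      rw [show n + 1 - m - 1 = (n - m - 1) + 1 by ring, zpow_add_one_apply, dist_self]
      exact hpos _
  · simp only [if_neg (show ¬ m + 1 + n ≤ m by omega)]
    congr 2
    ring

theorem isPseudoOrbit_orbit {δ : S → ℝ} (hpos : ∀ x, 0 < δ x) (a : S) :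
    IsPseudoOrbit f δ fun n => (f ^ n) a := fun n => by
  simp only [zpow_add_one_apply, dist_self]
  exact hpos _

/-- The backward orbit of `a`, a chain from `a` to `b`, and the forward orbit of `b`, joined. -/
theorem Chain.exists_pseudoOrbit {δ : S → ℝ} (hpos : ∀ x, 0 < δ x) {a b : S}
    (h : Chain f δ a b) : ∃ N : ℤ, 0 < N ∧ ∃ u : ℤ → S, IsPseudoOrbit f δ u ∧
      (∀ n ≤ 0, u n = (f ^ n) a) ∧ ∀ n : ℤ, 0 ≤ n → u (N + n) = (f ^ n) b := by
  induction h with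
  | single hab =>
    obtain ⟨v, h1, h2, h3⟩ := (isPseudoOrbit_orbit (f := f) hpos a).exists_splice hpos
      (m := 0) (by simpa only [zpow_zero_apply] using hab)
    exact ⟨1, one_pos, v, h1, h2, fun n hn => by simpa using h3 n hn⟩
  | tail _ hbc ih =>
    obtain ⟨N, hN, u, h1, h2, h3⟩ := ih
    have h4 := h3 0 le_rfl
    rw [add_zero, zpow_zero_apply] at h4
    obtain ⟨v, h5, h6, h7⟩ := h1.exists_splice hpos (m := N) (by rwa [h4])
    exact ⟨N + 1, by omega, v, h5, fun n hn => by rw [h6 n (by omega), h2 n hn], h7⟩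

/-- Two chains back and forth give a periodic pseudo-orbit. -/
theorem Chain.exists_periodic {δ : S → ℝ} (hpos : ∀ x, 0 < δ x) {a b : S}
    (hab : Chain f δ a b) (hba : Chain f δ b a) : ∃ M N : ℤ, 0 < M ∧ M < N ∧ ∃ u : ℤ → S,
      IsPseudoOrbit f δ u ∧ u 0 = a ∧ u M = b ∧ ∀ n, u (n + N) = u n := by
  obtain ⟨M, hM, u, hu, hu1, hu2⟩ := hab.exists_pseudoOrbit hpos
  obtain ⟨L, hL, v, hv, hv1, hv2⟩ := hba.exists_pseudoOrbit hpos
  have u0 : u 0 = a := by rw [hu1 0 le_rfl, zpow_zero_apply]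
  have uM : u M = b := by simpa only [add_zero, zpow_zero_apply] using hu2 0 le_rfl
  have v0 : v 0 = b := by rw [hv1 0 le_rfl, zpow_zero_apply]
  have vL : v L = a := by simpa only [add_zero, zpow_zero_apply] using hv2 0 le_rfl
  -- One period: the first chain up to time M, then the second, extended below by reduction modulo M
  -- + L.
  let w : ℤ → S := fun r => if r < M then u r else v (r - M)
  have hw : ∀ r : ℤ, dist (f (w r)) (w (r + 1)) < δ (f (w r)) := fun r => by
    rcases lt_trichotomy (r + 1) M with h | h | h
    · simp only [w, if_pos h, if_pos (show r < M by omega)]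
      exact hu r
    · simp only [w, if_neg (show ¬ r + 1 < M by omega), if_pos (show r < M by omega)]
      rw [h, sub_self, v0, ← uM, ← h]
      exact hu r
    · simp only [w, if_neg (show ¬ r + 1 < M by omega), if_neg (show ¬ r < M by omega)]
      rw [show r + 1 - M = r - M + 1 by ring]
      exact hv _
  have w0 : w 0 = a := by simp only [w, if_pos hM, u0]
  have wN : w (M + L) = a := by
    simp only [w, if_neg (show ¬ M + L < M by omega), add_sub_cancel_left, vL]
  refine ⟨M, M + L, hM, by omega, fun n => w (n % (M + L)), fun n => ?_, ?_, ?_, fun n => ?_⟩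
  · have h0 := Int.emod_nonneg n (show M + L ≠ 0 by omega)
    have h1 := Int.emod_lt_of_pos n (show 0 < M + L by omega)
    have h2 : (n + 1) % (M + L) = (n % (M + L) + 1) % (M + L) := by rw [Int.emod_add_emod]
    simp only [h2]
    rcases eq_or_lt_of_le (show n % (M + L) + 1 ≤ M + L by omega) with h | h
    · have h3 := hw (n % (M + L))
      rw [h, wN] at h3
      rwa [h, Int.emod_self, w0]
    · rw [Int.emod_eq_of_lt (by omega) h]
      exact hw _
  · simp only [Int.zero_emod, w0]
  · simp only [Int.emod_eq_of_lt hM.le (show M < M + L by omega)]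
    simp only [w, if_neg (lt_irrefl M), sub_self, v0]
  · simp only [Int.add_emod_right]

end Chains

/-! ### The nonwandering set and limit sets. -/

section Nonwandering

variable {S : Type*} [TopologicalSpace S] {f : S ≃ₜ S}

theorem isClosed_nonwanderingSet (f : S ≃ₜ S) : IsClosed (nonwanderingSet f) := by
  refine isClosed_iff_frequently.2 fun x hx U hU hxU => ?_
  obtain ⟨y, hy, hyU⟩ := (hx.and_eventually (hU.mem_nhds hxU)).exists
  exact hy U hU hyU

theorem zpow_mem_nonwanderingSet {p : S} (hp : p ∈ nonwanderingSet f) (k : ℤ) :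
    (f ^ k) p ∈ nonwanderingSet f := by
  intro U hU hpU
  obtain ⟨n, hn, _, ⟨u, hu, rfl⟩, hu'⟩ := hp ((f ^ k) ⁻¹' U) (hU.preimage (f ^ k).continuous) hpU
  refine ⟨n, hn, (f ^ n) ((f ^ k) u), mem_image_of_mem _ hu, ?_⟩
  rw [← zpow_natCast_apply, ← zpow_add_apply, add_comm, zpow_add_apply, zpow_natCast_apply]
  exact hu'

theorem mem_nonwanderingSet_of_periodic {z : S} {N : ℤ} (hN : 0 < N) (hz : (f ^ N) z = z) :
    z ∈ nonwanderingSet f := by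
  intro U _ hzU
  lift N to ℕ using hN.le
  rw [zpow_natCast_apply] at hz
  exact ⟨N, by omega, z, ⟨z, hzU, hz⟩, hzU⟩

theorem mem_omegaLim_iff {x y : S} :
    y ∈ omegaLim f x ↔ ∀ U ∈ 𝓝 y, ∀ m : ℕ, ∃ n ≥ m, (f ^ n) x ∈ U := by
  rw [omegaLim, mem_omegaLimit_singleton_iff_mapClusterPt, mapClusterPt_iff_frequently]
  simp only [frequently_atTop]

theorem omegaLim_subset_nonwanderingSet (f : S ≃ₜ S) (x : S) :
    omegaLim f x ⊆ nonwanderingSet f := by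
  intro y hy U hU hyU
  rw [mem_omegaLim_iff] at hy
  obtain ⟨n, -, hn⟩ := hy U (hU.mem_nhds hyU) 0
  obtain ⟨m, hm, hm'⟩ := hy U (hU.mem_nhds hyU) (n + 1)
  refine ⟨m - n, by omega, (f ^ m) x, ⟨_, hn, ?_⟩, hm'⟩
  rw [← Homeomorph.mul_apply, ← pow_add, Nat.sub_add_cancel (by omega)]

theorem zpow_mem_omegaLim {x y : S} (hy : y ∈ omegaLim f x) (k : ℤ) :
    (f ^ k) y ∈ omegaLim f x := by
  rw [mem_omegaLim_iff] at hy ⊢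
  intro U hU m
  obtain ⟨n, hn, hnU⟩ := hy ((f ^ k) ⁻¹' U) ((f ^ k).continuous.continuousAt hU) (m + k.natAbs)
  refine ⟨(k + n).toNat, by omega, ?_⟩
  rw [← zpow_natCast_apply, Int.toNat_of_nonneg (by omega), zpow_add_apply, zpow_natCast_apply]
  exact hnU

end Nonwandering

/-! ### Chain classes of nonwandering points. -/

section NonwanderingChains

variable {S : Type*} [MetricSpace S] {f : S ≃ₜ S}

theorem reach_self {p : S} (hp : p ∈ nonwanderingSet f) : Reach f p p := by
  intro δ h1 h2
  obtain ⟨δ', h3, h4, U, hU, V, hV, h5⟩ := Chain.exists_perturb (f := f) h1 h2 p p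
  obtain ⟨W, hW, hWo, hpW⟩ := mem_nhds_iff.1 (inter_mem hU hV)
  obtain ⟨n, hn, _, ⟨u, hu, rfl⟩, hu'⟩ := hp W hWo hpW
  refine h5 u (hW hu).1 _ (hW hu').2 ?_
  rw [← zpow_natCast_apply]
  exact reach_zpow f u (by omega) δ' h3 h4

/-- Unless p is fixed, a small neighbourhood of p is disjoint from its image, so a return takes time
at least 2 and can be started one step late, at f u. -/
theorem reach_of_map {p : S} (hp : p ∈ nonwanderingSet f) : Reach f (f p) p := by
  by_cases hfix : f p = p
  · rw [hfix]; exact reach_self hp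
  intro δ h1 h2
  obtain ⟨δ', h3, h4, U, hU, V, hV, h5⟩ := Chain.exists_perturb (f := f) h1 h2 (f p) p
  obtain ⟨A, B, hA, hB, hpA, hpB, hAB⟩ := t2_separation hfix
  obtain ⟨W, hW, hWo, hpW⟩ := mem_nhds_iff.1
    (inter_mem (inter_mem (f.continuous.continuousAt hU) hV)
      (inter_mem (f.continuous.continuousAt (hA.mem_nhds hpA)) (hB.mem_nhds hpB)))
  obtain ⟨n, hn, _, ⟨u, hu, rfl⟩, hu'⟩ := hp W hWo hpW
  have hn1 : n ≠ 1 := by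
    rintro rfl
    rw [pow_one] at hu'
    exact hAB.le_bot ⟨(hW hu).2.1, (hW hu').2.2⟩
  refine h5 (f u) (hW hu).1.1 _ (hW hu').1.2 ?_
  have : (f ^ n) u = (f ^ ((n : ℤ) - 1)) (f u) := by
    rw [← zpow_one_apply f u, ← zpow_add_apply, sub_add_cancel, zpow_natCast_apply]
  rw [this]
  exact reach_zpow f (f u) (by omega) δ' h3 h4

theorem reach_zpow_of_nonwandering {p : S} (hp : p ∈ nonwanderingSet f) (k : ℤ) :
    Reach f p ((f ^ k) p) ∧ Reach f ((f ^ k) p) p := by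
  induction k with
  | zero => simpa only [zpow_zero_apply, and_self] using reach_self hp
  | succ k ih =>
    rw [zpow_add_one_apply]
    exact ⟨ih.1.trans (reach_map f _),
      (reach_of_map (zpow_mem_nonwanderingSet hp _)).trans ih.2⟩
  | pred k ih =>
    have h : (f ^ (-(k : ℤ))) p = f ((f ^ (-(k : ℤ) - 1)) p) := by
      rw [← zpow_add_one_apply, sub_add_cancel]
    rw [h] at ih
    exact ⟨ih.1.trans (reach_of_map (zpow_mem_nonwanderingSet hp _)),
      (reach_map f _).trans ih.2⟩

theorem reach_of_mem_omegaLim {x y : S} (hy : y ∈ omegaLim f x) : Reach f x y := by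
  intro δ h1 h2
  obtain ⟨δ', h3, h4, V, hV, h5⟩ := Chain.exists_end (f := f) h1 h2 y
  obtain ⟨n, hn, hn'⟩ := mem_omegaLim_iff.1 hy V hV 1
  refine h5 _ hn' x ?_
  rw [← zpow_natCast_apply]
  exact reach_zpow f x (by omega) δ' h3 h4

theorem reach_of_mem_omegaLim_of_mem {x y y' : S} (hy : y ∈ omegaLim f x)
    (hy' : y' ∈ omegaLim f x) : Reach f y y' := by
  intro δ h1 h2
  obtain ⟨δ', h3, h4, U, hU, V, hV, h5⟩ := Chain.exists_perturb (f := f) h1 h2 y y'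
  obtain ⟨n, -, hn⟩ := mem_omegaLim_iff.1 hy U hU 0
  obtain ⟨m, hm, hm'⟩ := mem_omegaLim_iff.1 hy' V hV (n + 1)
  refine h5 _ hn _ hm' ?_
  have : (f ^ m) x = (f ^ ((m : ℤ) - n)) ((f ^ n) x) := by
    rw [← zpow_natCast_apply f n, ← zpow_add_apply, sub_add_cancel, zpow_natCast_apply]
  rw [this]
  exact reach_zpow f _ (by omega) δ' h3 h4

/-- The chain class of a nonwandering point. -/
def chainClass (f : S ≃ₜ S) (p : S) : Set S :=
  {q | q ∈ nonwanderingSet f ∧ Reach f p q ∧ Reach f q p}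

theorem mem_chainClass_self {p : S} (hp : p ∈ nonwanderingSet f) : p ∈ chainClass f p :=
  ⟨hp, reach_self hp, reach_self hp⟩

theorem chainClass_eq {p q : S} (h : q ∈ chainClass f p) : chainClass f q = chainClass f p := by
  ext r
  exact ⟨fun hr => ⟨hr.1, h.2.1.trans hr.2.1, hr.2.2.trans h.2.2⟩,
    fun hr => ⟨hr.1, h.2.2.trans hr.2.1, hr.2.2.trans h.2.1⟩⟩

theorem zpow_mem_chainClass {p q : S} (h : q ∈ chainClass f p) (k : ℤ) :
    (f ^ k) q ∈ chainClass f p :=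
  have h' := reach_zpow_of_nonwandering h.1 k
  ⟨zpow_mem_nonwanderingSet h.1 k, h.2.1.trans h'.1, h'.2.trans h.2.2⟩

theorem isClosed_chainClass (f : S ≃ₜ S) (p : S) : IsClosed (chainClass f p) := by
  refine isClosed_iff_frequently.2 fun q hq => ?_
  have : (𝓝 q ⊓ 𝓟 (chainClass f p)).NeBot := frequently_mem_iff_neBot.1 hq
  have hid : Tendsto id (𝓝 q ⊓ 𝓟 (chainClass f p)) (𝓝 q) := tendsto_id.mono_left inf_le_left
  have hev : ∀ᶠ r in 𝓝 q ⊓ 𝓟 (chainClass f p), r ∈ chainClass f p :=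
    mem_inf_of_right (mem_principal_self _)
  exact ⟨(isClosed_nonwanderingSet f).mem_of_frequently_of_tendsto
      ((hev.mono fun r hr => hr.1).frequently) hid,
    reach_of_frequently tendsto_const_nhds hid (hev.mono fun r hr => hr.2.1),
    reach_of_frequently hid tendsto_const_nhds (hev.mono fun r hr => hr.2.2)⟩

end NonwanderingChains

/-! ### Expansivity, shadowing and local product structure. -/

section Shadowing

variable {S : Type*} [MetricSpace S] {f : S ≃ₜ S} {e ε δ : S → ℝ}

/-- `e` is an expansivity function of `f`. -/
def IsExpansivity (f : S ≃ₜ S) (e : S → ℝ) : Prop :=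
  ∀ x y : S, (∀ k : ℤ, dist ((f ^ k) x) ((f ^ k) y) ≤ e ((f ^ k) x)) → x = y

/-- Two families of orbits which become close at every time have the same limit. -/
theorem IsExpansivity.tendsto (he : IsExpansivity f e) (hε : IsFine e ε) {ι : Type*}
    {l : Ultrafilter ι} {a b : ι → S} {p : S} (ha : Tendsto a l (𝓝 p))
    (h : ∀ j : ℤ, ∀ᶠ i in (l : Filter ι),
      dist ((f ^ j) (a i)) ((f ^ j) (b i)) ≤ ε ((f ^ j) (a i))) :
    Tendsto b l (𝓝 p) := by
  have hεc := hε.continuous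
  have hb : ∀ᶠ i in (l : Filter ι), b i ∈ Metric.closedBall p (2 * ε p) := by
    have h1 : ∀ᶠ i in (l : Filter ι), dist (a i) p + ε (a i) < 2 * ε p := by
      have hcont : Continuous fun y => dist y p + ε y := by fun_prop
      refine ha.eventually (hcont.continuousAt.eventually (gt_mem_nhds ?_))
      simp only [dist_self]
      linarith [hε.pos p]
    filter_upwards [h1, h 0] with i hi hi'
    simp only [zpow_zero_apply] at hi'
    rw [Metric.mem_closedBall]
    have := dist_triangle (b i) (a i) p
    rw [dist_comm (b i) (a i)] at this
    linarith
  -- Compactness gives `b` a limit q; passing to the limit at each time j shows that the orbits of p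
  -- and q are never separated.
  obtain ⟨q, -, hq⟩ := (hε.isCompact p).ultrafilter_le_nhds' (l.map b) hb
  have hq' : Tendsto b l (𝓝 q) := hq
  have hpq : p = q := he p q fun k => by
    refine le_trans ?_ (hε.le _)
    have hA := ((f ^ k).continuous.tendsto p).comp ha
    have hB := ((f ^ k).continuous.tendsto q).comp hq'
    exact le_of_tendsto_of_tendsto (hA.dist hB) ((hεc.tendsto _).comp hA) (h k)
  rwa [hpq]

theorem exists_ultrafilter_tendsto {g : S ≃ₜ S} {x : S}
    (h : ∃ K : Set S, IsCompact K ∧ ∀ n : ℕ, (g ^ n) x ∈ K) :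
    ∃ (l : Ultrafilter ℕ) (y : S), (l : Filter ℕ) ≤ atTop ∧
      Tendsto (fun n => (g ^ n) x) l (𝓝 y) := by
  obtain ⟨K, hK, h⟩ := h
  obtain ⟨y, -, hy⟩ := hK.ultrafilter_le_nhds' ((Ultrafilter.of atTop).map fun n => (g ^ n) x)
    (Eventually.of_forall (f := (Ultrafilter.of (atTop : Filter ℕ) : Filter ℕ)) h)
  exact ⟨Ultrafilter.of atTop, y, Ultrafilter.of_le _, hy⟩

/-- The alternative for the `g`-orbit of `x` at scale `ε`: either it is bounded, or it is shadowed
by `x` only. -/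
def BoundedOrRigid (g : S ≃ₜ S) (ε : S → ℝ) (x : S) : Prop :=
  (∃ K : Set S, IsCompact K ∧ ∀ n : ℕ, (g ^ n) x ∈ K) ∨
    ∀ z, (∀ n : ℕ, dist ((g ^ n) x) ((g ^ n) z) < ε ((g ^ n) x)) → z = x

theorem BoundedOrRigid.mono {g : S ≃ₜ S} {ε ε' : S → ℝ} {x : S} (h : BoundedOrRigid g ε x)
    (hle : ∀ y, ε' y ≤ ε y) : BoundedOrRigid g ε' x :=
  h.imp id fun h z hz => h z fun n => lt_of_lt_of_le (hz n) (hle _)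

theorem exists_boundedOrRigid [LocallyCompactSpace S] [SigmaCompactSpace S] (g : S ≃ₜ S) (x : S) :
    ∃ ε : S → ℝ, Continuous ε ∧ (∀ y, 0 < ε y) ∧ BoundedOrRigid g ε x := by
  by_cases h : ∃ K : Set S, IsCompact K ∧ ∀ n : ℕ, (g ^ n) x ∈ K
  · exact ⟨fun _ => 1, continuous_const, fun _ => one_pos, Or.inl h⟩
  · obtain ⟨ε, h1, h2, h3⟩ := exists_rigid_scale g x h
    exact ⟨ε, h1, h2, Or.inr h3⟩

/-- A point whose forward orbit shadows that of a nonwandering point `b` reaches `b`. -/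
theorem IsExpansivity.reach_forward (he : IsExpansivity f e) (hε : IsFine e ε) {b c : S}
    (hb : b ∈ nonwanderingSet f) (hbr : BoundedOrRigid f ε b)
    (h : ∀ n : ℤ, 0 ≤ n → dist ((f ^ n) b) ((f ^ n) c) < ε ((f ^ n) b)) : Reach f c b := by
  rcases hbr with hbr | hbr
  · obtain ⟨l, y, hl, hy⟩ := exists_ultrafilter_tendsto hbr
    have hc := he.tendsto hε (b := fun n : ℕ => (f ^ n) c) hy fun j => by
      filter_upwards [hl (eventually_ge_atTop j.natAbs)] with n hn
      simp only [← zpow_natCast_apply, ← zpow_add_apply]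
      exact (h (j + n) (by omega)).le
    -- The orbits of b and c share the limit point y: c reaches y along its own orbit, and y reaches
    -- b because every fⁿ(b) does.
    refine (reach_of_frequently tendsto_const_nhds hc ?_).trans
      (reach_of_frequently hy tendsto_const_nhds (Eventually.of_forall fun n => ?_))
    · filter_upwards [hl (eventually_ge_atTop 1)] with n hn
      rw [← zpow_natCast_apply]
      exact reach_zpow f c (by omega)
    · rw [← zpow_natCast_apply]
      exact (reach_zpow_of_nonwandering hb n).2
  · rw [hbr c fun n => by simpa only [zpow_natCast_apply] using h n (by omega)]
    exact reach_self hb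

/-- A point whose backward orbit shadows that of a nonwandering point `a` is reached from `a`. -/
theorem IsExpansivity.reach_backward (he : IsExpansivity f e) (hε : IsFine e ε) {a c : S}
    (ha : a ∈ nonwanderingSet f) (har : BoundedOrRigid f⁻¹ ε a)
    (h : ∀ n : ℤ, n ≤ 0 → dist ((f ^ n) a) ((f ^ n) c) < ε ((f ^ n) a)) : Reach f a c := by
  rcases har with har | har
  · obtain ⟨l, y, hl, hy⟩ := exists_ultrafilter_tendsto har
    have hc := he.tendsto hε (b := fun n : ℕ => (f⁻¹ ^ n) c) hy fun j => by
      filter_upwards [hl (eventually_ge_atTop j.natAbs)] with n hn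
      simp only [inv_pow_apply, ← zpow_add_apply]
      exact (h (j + -n) (by omega)).le
    refine (reach_of_frequently tendsto_const_nhds hy (Eventually.of_forall fun n => ?_)).trans
      (reach_of_frequently hc tendsto_const_nhds ?_)
    · rw [inv_pow_apply]
      exact (reach_zpow_of_nonwandering ha _).1
    · filter_upwards [hl (eventually_ge_atTop 1)] with n hn
      rw [inv_pow_apply]
      exact reach_of_zpow_neg f c (by omega)
  · rw [har c fun n => by simpa only [inv_pow_apply] using h (-n) (by omega)]
    exact reach_self ha

/-- `δ`-pseudo-orbits of `f` are `ε`-shadowed. -/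
def ShadowedAt (f : S ≃ₜ S) (δ ε : S → ℝ) : Prop :=
  ∀ u : ℤ → S, IsPseudoOrbit f δ u → ∃ z : S, Shadows f ε u z

/-- The local product structure on nonwandering points. -/
theorem IsExpansivity.reach_of_step (he : IsExpansivity f e) (hε : IsFine e ε)
    (hδ : ∀ x, 0 < δ x) (hsh : ShadowedAt f δ ε) {a b : S}
    (ha : a ∈ nonwanderingSet f) (hb : b ∈ nonwanderingSet f)
    (har : BoundedOrRigid f⁻¹ ε a) (hbr : BoundedOrRigid f ε (f b))
    (h : dist (f a) (f b) < δ (f a)) : Reach f a b := by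
  obtain ⟨u, hu, hu1, hu2⟩ := (isPseudoOrbit_orbit (f := f) hδ a).exists_splice hδ
    (m := 0) (c := f b) (by simpa only [zpow_zero_apply] using h)
  obtain ⟨w, hw⟩ := hsh u hu
  have hb' : f b ∈ nonwanderingSet f := by
    simpa only [zpow_one_apply] using zpow_mem_nonwanderingSet hb 1
  have h1 : Reach f a w := he.reach_backward hε ha har fun n hn => by
    simpa only [hu1 n hn] using hw n
  have h2 : Reach f (f w) (f b) := he.reach_forward hε hb' hbr fun n hn => by
    have := hw (0 + 1 + n)
    rw [hu2 n hn, show (0 : ℤ) + 1 + n = n + 1 by ring, zpow_add_apply, zpow_one_apply] at this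
    exact this
  exact ((h1.trans (reach_map f w)).trans h2).trans (reach_of_map hb)

theorem exists_compact_of_periodic {z : S} {N : ℤ} (hN : 0 < N) (hz : (f ^ N) z = z) :
    ∃ K : Set S, IsCompact K ∧ ∀ n : ℤ, (f ^ n) z ∈ K := by
  refine ⟨(fun n : ℤ => (f ^ n) z) '' Ico 0 N, ((finite_Ico 0 N).image _).isCompact,
    fun n => ⟨n % N, ⟨Int.emod_nonneg n hN.ne', Int.emod_lt_of_pos n hN⟩, ?_⟩⟩
  conv_rhs => rw [← Int.emod_add_mul_ediv n N, zpow_add_apply, zpow_mul_apply_of_fixed f hz]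

end Shadowing

/-! ### The spectral decomposition into chain classes. -/

section SpectralDecomposition

theorem isOpen_setOf_step {S : Type*} [MetricSpace S] {f : S ≃ₜ S} {δ : S → ℝ}
    (hδ : Continuous δ) (p : S) :
    IsOpen {z | dist (f p) (f z) < δ (f p) ∧ dist (f z) (f p) < δ (f z)} := by
  have hf := f.continuous
  have h1 : IsOpen {z | dist (f p) (f z) < δ (f p)} :=
    isOpen_lt (continuous_const.dist hf) continuous_const
  have h2 : IsOpen {z | dist (f z) (f p) < δ (f z)} :=
    isOpen_lt (hf.dist continuous_const) (hδ.comp hf)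
  exact h1.inter h2

variable {S : Type*} [MetricSpace S] {f : S ≃ₜ S} {e ε : S → ℝ}

theorem TopExpansive.exists_isExpansivity (h : TopExpansive f) :
    ∃ e : S → ℝ, Continuous e ∧ (∀ x, 0 < e x) ∧ IsExpansivity f e := by
  obtain ⟨e, h1, h2, h3⟩ := h
  refine ⟨e, h1, h2, fun x y hxy => ?_⟩
  by_contra hne
  obtain ⟨k, hk⟩ := h3 x y hne
  exact absurd (hxy k) (not_le.2 hk)

theorem TopShadowing.exists_shadowedAt (h : TopShadowing f) (hε : IsFine e ε) :
    ∃ δ : S → ℝ, Continuous δ ∧ (∀ x, 0 < δ x) ∧ ShadowedAt f δ ε :=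
  h ε hε.continuous hε.pos

/-- A periodic pseudo-orbit through p and q is shadowed by a periodic orbit meeting U and V. Two
scales are needed: ε₁, with its δ₁, makes the local product structure work between p and nearby
periodic points; ε₂ then puts the shadowing point that close to p. -/
theorem transitiveOn_chainClass [LocallyCompactSpace S] [SigmaCompactSpace S]
    (hf : IsTopAnosov f) (p₀ : S) : TransitiveOn f (chainClass f p₀) := by
  obtain ⟨e, hec, hep, he⟩ := hf.1.exists_isExpansivity
  obtain ⟨ε₀, hε₀⟩ := exists_isFine hec hep
  rintro U V hU hV ⟨p, hpU, hp⟩ ⟨q, hqV, hq⟩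
  obtain ⟨α, hαc, hαp, hα⟩ := exists_boundedOrRigid f⁻¹ p
  obtain ⟨β, hβc, hβp, hβ⟩ := exists_boundedOrRigid f (f p)
  have hε₁ := (hε₀.min hαc hαp).min hβc hβp
  set ε₁ : S → ℝ := fun x => min (min (ε₀ x) (α x)) (β x) with hε₁def
  have hα₁ : BoundedOrRigid f⁻¹ ε₁ p :=
    hα.mono fun y => (min_le_left _ _).trans (min_le_right _ _)
  have hβ₁ : BoundedOrRigid f ε₁ (f p) := hβ.mono fun y => min_le_right _ _
  obtain ⟨δ₁, hδ₁c, hδ₁p, hδ₁⟩ := hf.2.exists_shadowedAt hε₁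
  have hW : IsOpen {z | z ∈ U ∧ dist (f p) (f z) < δ₁ (f p) ∧ dist (f z) (f p) < δ₁ (f z)} :=
    hU.inter (isOpen_setOf_step hδ₁c p)
  obtain ⟨r, hr, hrW⟩ := Metric.isOpen_iff.1 hW p
    ⟨hpU, by simpa using hδ₁p _, by simpa using hδ₁p _⟩
  obtain ⟨s, hs, hsV⟩ := Metric.isOpen_iff.1 hV q hqV
  have hε₂ := (hε₁.min (ε' := fun _ => r) continuous_const fun _ => hr).min
    (ε' := fun _ => s) continuous_const fun _ => hs
  obtain ⟨δ₂, hδ₂c, hδ₂p, hδ₂⟩ := hf.2.exists_shadowedAt hε₂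
  obtain ⟨M, N, hM, hMN, u, hu, hu0, huM, hper⟩ := Chain.exists_periodic hδ₂p
    ((hp.2.2.trans hq.2.1) δ₂ hδ₂c hδ₂p) ((hq.2.2.trans hp.2.1) δ₂ hδ₂c hδ₂p)
  obtain ⟨z, hz⟩ := hδ₂ u hu
  have hzp : z ∈ Metric.ball p r := by
    have := hz 0
    rw [hu0, zpow_zero_apply] at this
    rw [Metric.mem_ball, dist_comm]
    exact lt_of_lt_of_le this ((min_le_left _ _).trans (min_le_right _ _))
  have hzq : (f ^ M) z ∈ Metric.ball q s := by
    have := hz M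
    rw [huM] at this
    rw [Metric.mem_ball, dist_comm]
    exact lt_of_lt_of_le this (min_le_right _ _)
  -- By periodicity of u, both z and f^N(z) shadow u, so expansivity identifies them; this is where
  -- the factor 2 in `IsFine` is used.
  have hzN : (f ^ N) z = z := by
    refine (he z _ fun k => ?_).symm
    have h1 := hz k
    have h2 := hz (k + N)
    rw [hper k, zpow_add_apply] at h2
    have h3 := hε₂.two_mul_le _ _ h1
    have h4 := dist_triangle_left ((f ^ k) z) ((f ^ k) ((f ^ N) z)) (u k)
    linarith
  have hN : 0 < N := hM.trans hMN
  have hzΩ := mem_nonwanderingSet_of_periodic hN hzN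
  obtain ⟨K, hK, hKz⟩ := exists_compact_of_periodic hN hzN
  obtain ⟨hzU, hpz, hzp'⟩ := hrW hzp
  have h1 : Reach f p z := he.reach_of_step hε₁ hδ₁p hδ₁ hp.1 hzΩ hα₁
    -- A periodic orbit is bounded, so the alternative holds for z at any scale, although z was
    -- chosen after ε₁.
    (Or.inl ⟨K, hK, fun n => by
      rw [← zpow_one_apply f z, ← zpow_natCast_apply, ← zpow_add_apply]
      exact hKz _⟩) hpz
  have h2 : Reach f z p := he.reach_of_step hε₁ hδ₁p hδ₁ hzΩ hp.1
    (Or.inl ⟨K, hK, fun n => by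
      rw [inv_pow_apply]
      exact hKz _⟩) hβ₁ hzp'
  have hzc : z ∈ chainClass f p₀ := ⟨hzΩ, hp.2.1.trans h1, h2.trans hp.2.2⟩
  refine ⟨M.toNat, (f ^ M) z, ⟨z, ⟨hzU, hzc⟩, ?_⟩, hsV hzq, zpow_mem_chainClass hzc M⟩
  rw [← zpow_natCast_apply, Int.toNat_of_nonneg hM.le]

/-- The chain classes of nonwandering points form a spectral decomposition. -/
theorem isSpectralDecomposition_chainClasses [LocallyCompactSpace S] [SigmaCompactSpace S]
    (hf : IsTopAnosov f) :
    IsSpectralDecomposition f (chainClass f '' nonwanderingSet f) where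
  sUnion_eq := by
    ext q
    constructor
    · rintro ⟨_, ⟨p, -, rfl⟩, hq⟩
      exact hq.1
    · exact fun hq => ⟨_, mem_image_of_mem _ hq, mem_chainClass_self hq⟩
  pairwiseDisjoint := by
    rintro _ ⟨p, -, rfl⟩ _ ⟨q, -, rfl⟩ hne
    refine Set.disjoint_left.2 fun r hr hr' => hne ?_
    rw [← chainClass_eq hr, ← chainClass_eq hr']
  nonempty := by
    rintro _ ⟨p, hp, rfl⟩
    exact ⟨p, mem_chainClass_self hp⟩
  isClosed := by
    rintro _ ⟨p, -, rfl⟩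
    exact isClosed_chainClass f p
  invariant := by
    rintro _ ⟨p, -, rfl⟩
    ext q
    constructor
    · rintro ⟨r, hr, rfl⟩
      simpa only [zpow_one_apply] using zpow_mem_chainClass hr 1
    · refine fun hq => ⟨_, zpow_mem_chainClass hq (-1), ?_⟩
      rw [← zpow_one_apply f, zpow_apply_zpow_neg]
  transitive := by
    rintro _ ⟨p, -, rfl⟩
    exact transitiveOn_chainClass hf p

end SpectralDecomposition

/-! ### The trapping region and its maximal invariant set. -/

section Attractor

variable {S : Type*} [MetricSpace S] {f : S ≃ₜ S} {e ε δ : S → ℝ}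

/-- The set of points reached from `x` by `δ`-chains is open. -/
theorem isOpen_setOf_chain (f : S ≃ₜ S) (δ : S → ℝ) (x : S) : IsOpen {y | Chain f δ x y} := by
  refine isOpen_iff_mem_nhds.2 fun y hy => ?_
  obtain ⟨a, hxa, ha⟩ := Relation.TransGen.tail'_iff.1 hy
  have hd : ∀ᶠ z in 𝓝 y, dist (f a) z < δ (f a) :=
    (continuous_const.dist continuous_id).continuousAt.eventually (gt_mem_nhds ha)
  exact hd.mono fun z hz => Relation.TransGen.tail' hxa hz

/-- The set of points reached from `x` by `δ`-chains is a trapping region. -/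
theorem closure_image_setOf_chain_subset (hδ : Continuous δ) (hpos : ∀ x, 0 < δ x) (x : S) :
    closure (f '' {y | Chain f δ x y}) ⊆ {y | Chain f δ x y} := by
  intro y hy
  have hd : ∀ᶠ z in 𝓝 y, dist z y < δ z := by
    have h : IsOpen {z | dist z y < δ z} := isOpen_lt (by fun_prop) hδ
    exact h.mem_nhds (by simpa using hpos y)
  obtain ⟨_, ⟨a, ha, rfl⟩, hay⟩ := ((mem_closure_iff_frequently.1 hy).and_eventually hd).exists
  exact Relation.TransGen.tail ha hay

/-- A chain from a backward rigid point `x` follows the orbit of `x`. -/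
theorem Chain.exists_dist_lt (hδ : ∀ x, 0 < δ x) (hsh : ShadowedAt f δ ε) {x y : S}
    (hx : ∀ z, (∀ n : ℕ, dist ((f⁻¹ ^ n) x) ((f⁻¹ ^ n) z) < ε ((f⁻¹ ^ n) x)) → z = x)
    (h : Chain f δ x y) :
    ∃ N : ℤ, 0 < N ∧ ∀ n : ℤ, 0 ≤ n →
      dist ((f ^ n) y) ((f ^ (N + n)) x) < ε ((f ^ n) y) := by
  obtain ⟨N, hN, u, hu, hu1, hu2⟩ := h.exists_pseudoOrbit hδ
  obtain ⟨z, hz⟩ := hsh u hu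
  have hzx : z = x := hx z fun n => by
    have := hz (-n)
    rwa [hu1 _ (by omega), ← inv_pow_apply, ← inv_pow_apply] at this
  refine ⟨N, hN, fun n hn => ?_⟩
  have := hz (N + n)
  rwa [hu2 n hn, hzx] at this

theorem iInter_image_subset_omegaLim (he : IsExpansivity f e) (hε : IsFine e ε)
    (hδ : ∀ x, 0 < δ x) (hsh : ShadowedAt f δ ε) {x : S}
    (hx : ∀ z, (∀ n : ℕ, dist ((f⁻¹ ^ n) x) ((f⁻¹ ^ n) z) < ε ((f⁻¹ ^ n) x)) → z = x) :
    (⋂ n : ℕ, (f ^ n) '' {y | Chain f δ x y}) ⊆ omegaLim f x := by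
  intro p hp
  have hN : ∀ n : ℕ, ∃ N : ℕ, n ≤ N ∧ ∀ j : ℤ, -(n : ℤ) ≤ j →
      dist ((f ^ j) p) ((f ^ j) ((f ^ N) x)) < ε ((f ^ j) p) := fun n => by
    obtain ⟨y, hy, rfl⟩ := mem_iInter.1 hp n
    obtain ⟨N, hN, h⟩ := Chain.exists_dist_lt hδ hsh hx hy
    -- Here p = fⁿ(y), and y is followed by f^N(x), so p is followed by f^(N+n)(x); time -n for p is
    -- time 0 for y.
    refine ⟨(N + n).toNat, by omega, fun j hj => ?_⟩
    have := h (j + n) (by omega)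
    rw [← zpow_natCast_apply, ← zpow_natCast_apply, ← zpow_add_apply, ← zpow_add_apply,
      Int.toNat_of_nonneg (by omega), show j + (N + (n : ℤ)) = N + (j + n) by ring]
    exact this
  choose N hN hNp using hN
  have ht : Tendsto (fun n => (f ^ N n) x) (Ultrafilter.of (atTop : Filter ℕ)) (𝓝 p) :=
    he.tendsto hε (a := fun _ => p) tendsto_const_nhds fun j => by
      filter_upwards [Ultrafilter.of_le _ (eventually_ge_atTop j.natAbs)] with n hn
      exact (hNp n j (by omega)).le
  rw [mem_omegaLim_iff]
  intro U hU m
  obtain ⟨n, hnU, hn⟩ := ((ht.eventually hU).and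
    (Ultrafilter.of_le _ (eventually_ge_atTop m))).exists
  exact ⟨N n, hn.trans (hN n), hnU⟩

theorem omegaLim_subset_iInter_image (hδ : Continuous δ) (hpos : ∀ x, 0 < δ x) (x : S) :
    omegaLim f x ⊆ ⋂ n : ℕ, (f ^ n) '' {y | Chain f δ x y} := by
  refine fun y hy => mem_iInter.2 fun n => ⟨_,
    reach_of_mem_omegaLim (zpow_mem_omegaLim hy (-n)) δ hδ hpos, ?_⟩
  rw [← zpow_natCast_apply, zpow_apply_zpow_neg]

/-- An orbit that is unbounded both ways is rigid, which forces its points to be isolated. -/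
theorem exists_compact_forward [LocallyCompactSpace S] [SigmaCompactSpace S]
    (hf : IsTopAnosov f) {x : S} [(𝓝[≠] x).NeBot]
    (hx : ¬ ∃ K : Set S, IsCompact K ∧ ∀ n : ℕ, (f⁻¹ ^ n) x ∈ K) :
    ∃ K : Set S, IsCompact K ∧ ∀ n : ℕ, (f ^ n) x ∈ K := by
  by_contra hx'
  have hfx : ¬ ∃ K : Set S, IsCompact K ∧ ∀ n : ℕ, (f ^ n) (f x) ∈ K := by
    rintro ⟨K, hK, h⟩
    refine hx' ⟨insert x K, hK.insert x, fun n => ?_⟩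
    cases n with
    | zero => exact mem_insert _ _
    | succ n => exact mem_insert_of_mem _ (h n)
  obtain ⟨e, hec, hep, he⟩ := hf.1.exists_isExpansivity
  obtain ⟨ε₀, hε₀⟩ := exists_isFine hec hep
  obtain ⟨α, hαc, hαp, hα⟩ := exists_rigid_scale f⁻¹ x hx
  obtain ⟨β, hβc, hβp, hβ⟩ := exists_rigid_scale f (f x) hfx
  have hε := (hε₀.min hαc hαp).min hβc hβp
  obtain ⟨δ, hδc, hδp, hδ⟩ := hf.2.exists_shadowedAt hε
  have hxW := (isOpen_setOf_step (f := f) hδc x).mem_nhds (x := x)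
    ⟨by simpa using hδp _, by simpa using hδp _⟩
  obtain ⟨y, ⟨hy1, hy2⟩, hyx⟩ :=
    ((eventually_nhdsWithin_of_eventually_nhds hxW).and
      (self_mem_nhdsWithin : ∀ᶠ y in 𝓝[≠] x, y ∈ ({x}ᶜ : Set S))).exists
  -- The two products of x and a nearby y: u has the past of x and the future of y, v the reverse.
  -- Rigidity makes x shadow both, so x follows y at all times and equals it.
  obtain ⟨u, hu, hu1, hu2⟩ := (isPseudoOrbit_orbit (f := f) hδp x).exists_splice hδp
    (m := 0) (c := f y) (by simpa only [zpow_zero_apply] using hy1)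
  obtain ⟨v, hv, hv1, hv2⟩ := (isPseudoOrbit_orbit (f := f) hδp y).exists_splice hδp
    (m := 0) (c := f x) (by simpa only [zpow_zero_apply] using hy2)
  obtain ⟨z, hz⟩ := hδ u hu
  obtain ⟨w, hw⟩ := hδ v hv
  have hzx : z = x := hα z fun n => by
    have := hz (-n)
    rw [hu1 _ (by omega), ← inv_pow_apply, ← inv_pow_apply] at this
    exact lt_of_lt_of_le this ((min_le_left _ _).trans (min_le_right _ _))
  have hwx : w = x := by
    refine f.injective (hβ (f w) fun n => ?_)
    have := hw (0 + 1 + n)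
    rw [hv2 n (by omega), show (0 : ℤ) + 1 + n = n + 1 by ring, zpow_add_apply, zpow_one_apply,
      zpow_natCast_apply, zpow_natCast_apply] at this
    exact lt_of_lt_of_le this (min_le_right _ _)
  refine hyx (he y x fun k => ?_)
  rcases le_or_gt k 0 with hk | hk
  · have := hw k
    rw [hv1 k hk, hwx] at this
    exact this.le.trans (hε.le _)
  · have := hz k
    rw [show k = 0 + 1 + (k - 1) by ring, hu2 (k - 1) (by omega), hzx, ← zpow_one_apply f,
      ← zpow_add_apply, show k - 1 + 1 = 0 + 1 + (k - 1) by ring] at this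
    rw [show k = 0 + 1 + (k - 1) by ring]
    exact this.le.trans (hε.le _)

theorem omegaLim_nonempty {x : S} (h : ∃ K : Set S, IsCompact K ∧ ∀ n : ℕ, (f ^ n) x ∈ K) :
    (omegaLim f x).Nonempty := by
  obtain ⟨l, y, hl, hy⟩ := exists_ultrafilter_tendsto h
  refine ⟨y, mem_omegaLim_iff.2 fun U hU m => ?_⟩
  obtain ⟨n, hnU, hn⟩ := ((hy.eventually hU).and (hl (eventually_ge_atTop m))).exists
  exact ⟨n, hn, hnU⟩

/-- An isolated point would be clopen, hence by connectedness the whole space, which would be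
compact. -/
theorem neBot_nhdsNE_of_noncompact [ConnectedSpace S] [NoncompactSpace S] (x : S) :
    (𝓝[≠] x).NeBot := by
  refine ⟨fun h => ?_⟩
  have hx : IsOpen ({x} : Set S) := isOpen_singleton_iff_punctured_nhds x |>.2 h
  have huniv := IsClopen.eq_univ ⟨isClosed_singleton, hx⟩ (singleton_nonempty x)
  exact noncompact_univ S (huniv ▸ isCompact_singleton)

end Attractor

end TopAnosov

theorem mainTheorem7 {S : Type*} [MetricSpace S] [SecondCountableTopology S]
    [ConnectedSpace S] [NoncompactSpace S] [ChartedSpace (EuclideanSpace ℝ (Fin 2)) S]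
    (f : S ≃ₜ S) (hf : TopAnosov.IsTopAnosov f)
    (x : S) (hx : TopAnosov.UnboundedBackwardOrbit f x) :
    ∃ Λ : Set S, TopAnosov.IsBasicSet f Λ ∧ TopAnosov.IsAttracting f Λ ∧
      TopAnosov.omegaLim f x ⊆ Λ := by
  open TopAnosov in
  have : LocallyCompactSpace S := ChartedSpace.locallyCompactSpace (EuclideanSpace ℝ (Fin 2)) S
  have := neBot_nhdsNE_of_noncompact x
  have hx' : ¬ ∃ K : Set S, IsCompact K ∧ ∀ n : ℕ, (f⁻¹ ^ n) x ∈ K := by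
    simp only [inv_pow_apply]
    exact hx
  obtain ⟨y, hy⟩ := omegaLim_nonempty (exists_compact_forward hf hx')
  obtain ⟨e, hec, hep, he⟩ := hf.1.exists_isExpansivity
  obtain ⟨ε₀, hε₀⟩ := exists_isFine hec hep
  obtain ⟨α, hαc, hαp, hα⟩ := exists_rigid_scale f⁻¹ x hx'
  have hε := hε₀.min hαc hαp
  obtain ⟨δ, hδc, hδp, hδ⟩ := hf.2.exists_shadowedAt hε
  have hinter : (⋂ n : ℕ, (f ^ n) '' {y | Chain f δ x y}) = omegaLim f x :=
    (iInter_image_subset_omegaLim he hε hδp hδ fun z hz =>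
      hα z fun n => lt_of_lt_of_le (hz n) (min_le_right _ _)).antisymm
    (omegaLim_subset_iInter_image hδc hδp x)
  -- For q in the class of y, each f^(-n)(q) is reached from x through y, so q lies in every fⁿ(U),
  -- hence in ω(x).
  have hclass : chainClass f y = omegaLim f x := by
    refine Subset.antisymm (fun q hq => ?_) fun q hq =>
      ⟨omegaLim_subset_nonwanderingSet f x hq, reach_of_mem_omegaLim_of_mem hy hq,
        reach_of_mem_omegaLim_of_mem hq hy⟩
    rw [← hinter]
    refine mem_iInter.2 fun n => ⟨_, ((reach_of_mem_omegaLim hy).trans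
      (zpow_mem_chainClass hq (-n)).2.1) δ hδc hδp, ?_⟩
    rw [← zpow_natCast_apply, zpow_apply_zpow_neg]
  refine ⟨omegaLim f x, ⟨_, isSpectralDecomposition_chainClasses hf, y,
    omegaLim_subset_nonwanderingSet f x hy, hclass⟩,
    ⟨{y | Chain f δ x y}, isOpen_setOf_chain f δ x,
      fun q hq => reach_of_mem_omegaLim hq δ hδc hδp,
      closure_image_setOf_chain_subset hδc hδp x, hinter⟩, Subset.rfl⟩
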